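/- **Setting.** Let $(\Omega,\mathbb T,\mu)$ be a complete $\sigma$-finite measure space and $E$ a separable Banach space. $L_0(\Omega,E)$ is the space of a.e. classes of measurable functions $\Omega\to E$. An integrand is a function $g:\Omega\times E\to[-\infty,+\infty]$; it is measurable if it is $\mathbb T\otimes\mathcal B(E)$-measurable; inequalities between integrands hold for all $e\in E$ outside a $\mu$-null set of $\omega$. Its integral functional is the upper integral $$I_g(x)=\int^*_\Omega g(\omega,x(\omega))\,d\mu=\inf\Big\{\int_\Omega u\,d\mu:\ u\in L_1(\Omega,\mathbb R),\ u\ge g(\cdot,x(\cdot))\ \text{a.e.}\Big\},\qquad \inf\emptyset=+\infty .$$ The differential quotient of an extended real function $F$ finite at $x_0$ is $[F](x_0,x,r)=r^{-1}(F(x_0+rx)-F(x_0))$, $r>0$; for an integrand it is taken for each fixed $\omega$. Let $\mathcal X$ be a normed linear subspace of $L_0(\Omega,E)$ (a linear subspace with some norm) that is decomposable ($x1_A+y1_{A^c}\in\mathcal X$ for all $x,y\in\mathcal X$, $A\in\mathbb T$) and has property $(\mathcal D)$: there is an increasing covering $(\Omega_n)$ of $\Omega$ by measurable sets with $L_\infty(\Omega,E)1_{\Omega_n}\subset\mathcal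 X$ for all $n$. A bornology on $\mathcal X$ is a hereditary family of subsets, stable by finite unions, covering $\mathcal X$. Let $\mathcal B$ be the integral bornology associated to a family $\{\phi_i\}_{i\in I}$ of nonnegative integrands with $\phi_i(\cdot,0)=0$; that is, $\mathcal B$ is a bornology on $\mathcal X$, and its members are exactly the sets contained in some $\{x\in\mathcal X: I_{\phi_i}(x)\le s\}$, $i\in I$, $s\in\mathbb R$. Let $f$ be a measurable integrand and $x_0\in\mathcal X$ with $I_f(x_0)$ finite. Let $x^*\in\mathcal X^*\cap L_0(\Omega,E^*_{\sigma^*})$; that is, $x^*:\Omega\to E^*$ is scalarly measurable, $\langle x^*(\cdot),x(\cdot)\rangle$ is integrable for every $x\in\mathcal X$, and $x\mapsto\langle x^*,x\rangle=\int_\Omega\langle x^*(\omega),x(\omega)\rangle\,d\mu$ is a continuous linear form on $\mathcal X$. **Theorem.** Consider the assertions: (a) $x^*$ is a $\mathcal B$-subderivative of $I_f$ at $x_0$: for all $B\in\mathcal B$, $\displaystyle\liminf_{r\to0_+}\inf_{x\in B}\big([I_f](x_0,x,r)-\langle x^*,x\rangle\big)\ge0$. (b) For every $i\in I$ and every $\varepsilon>0$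 there is a family $\{u_r\}_{r\in(0,1)}$ of nonnegative functions, integrable for all sufficiently small $r$, with $\|u_r\|_1\to0$ as $r\to0_+$, such that for all sufficiently small $r>0$ $$[f-\langle x^*,\cdot\rangle](x_0,\cdot,r)\ \ge\ -\varepsilon\phi_i-u_r ,$$ i.e. for almost every $\omega$ and all $e\in E$, $[f_\omega-\langle x^*(\omega),\cdot\rangle](x_0(\omega),e,r)\ge-\varepsilon\phi_i(\omega,e)-u_r(\omega)$. Then (b) implies (a). If in addition $\mu$ is atomless and the integrands $\phi_i$ are measurable, (a) and (b) are equivalent. -/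

import Mathlib

open MeasureTheory Filter Topology Set

noncomputable section

namespace IntegralSubdiff

/-- A measure is atomless when it has no atom: an atom is a measurable set of positive measure
every measurable subset of which is null or has null complement in it. (This is different from
`MeasureTheory.NoAtoms`, which speaks of points only.) -/
def IsAtomless {Ω : Type*} [MeasurableSpace Ω] (μ : Measure Ω) : Prop :=
  ∀ A : Set Ω, MeasurableSet A → μ A ≠ 0 →
    ∃ B : Set Ω, MeasurableSet B ∧ B ⊆ A ∧ μ B ≠ 0 ∧ μ (A \ B) ≠ 0

/-- The upper integral of an extended real valued function `v`: the infimum of the integrals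
of the integrable real functions that are a.e. above `v` (it is `⊤` when there are none). -/
def upperIntegral {Ω : Type*} [MeasurableSpace Ω] (μ : Measure Ω) (v : Ω → EReal) : EReal :=
  sInf {c : EReal | ∃ u : Ω → ℝ, Integrable u μ ∧ (∀ᵐ ω ∂μ, v ω ≤ (u ω : EReal)) ∧
    c = ((∫ ω, u ω ∂μ : ℝ) : EReal)}

/-- The integral functional `I_f` of an integrand `f : Ω × E → [-∞, ∞]`, on the space
`L₀(Ω, E)` of a.e. classes of measurable functions. -/
def integralFunctional {Ω E : Type*} [MeasurableSpace Ω] (μ : Measure Ω) [TopologicalSpace E]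
    (f : Ω → E → EReal) (x : Ω →ₘ[μ] E) : EReal :=
  upperIntegral μ (fun ω => f ω (x ω))

/-- The differential quotient `[F](x₀, x, r) = r⁻¹ (F (x₀ + r x) - F x₀)`. -/
def diffQuot {V : Type*} [AddCommGroup V] [Module ℝ V] (F : V → EReal) (x₀ x : V) (r : ℝ) :
    EReal :=
  ((r⁻¹ : ℝ) : EReal) * (F (x₀ + r • x) - F x₀)

/-- The linear form `ℓ` is a subderivative of `F` at `x₀` with respect to the bornology `ℬ`:
`F` is finite at `x₀`, and for every `B` in `ℬ`,
`liminf_{r → 0+} inf_{x ∈ B} ([F](x₀, x, r) - ℓ x) ≥ 0`. -/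
def IsSubderivative {V : Type*} [AddCommGroup V] [Module ℝ V] (ℬ : Bornology V)
    (F : V → EReal) (x₀ : V) (ℓ : V →ₗ[ℝ] ℝ) : Prop :=
  F x₀ ≠ ⊤ ∧ F x₀ ≠ ⊥ ∧
    ∀ B : Set V, @Bornology.IsBounded V ℬ B →
      0 ≤ liminf (fun r : ℝ => ⨅ x ∈ B, (diffQuot F x₀ x r - ((ℓ x : ℝ) : EReal))) (𝓝[>] 0)

section FunctionSpace

variable {Ω E : Type*} [MeasurableSpace Ω] {μ : Measure Ω}
  [NormedAddCommGroup E] [NormedSpace ℝ E]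

/-- Decomposability: with `x`, `y` also `x 1_A + y 1_{Aᶜ}` belongs to `X`, for measurable `A`. -/
def Decomposable (X : Submodule ℝ (Ω →ₘ[μ] E)) : Prop :=
  ∀ x ∈ X, ∀ y ∈ X, ∀ A : Set Ω, MeasurableSet A → ∀ z : Ω →ₘ[μ] E,
    (∀ᵐ ω ∂μ, z ω = A.indicator x ω + Aᶜ.indicator y ω) → z ∈ X

/-- Property `(𝒟)`: there is an increasing covering `(Ωₙ)` of `Ω` by measurable sets such that
`L_∞(Ω, E) 1_{Ωₙ} ⊆ X` for every `n`. -/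
def PropertyD (X : Submodule ℝ (Ω →ₘ[μ] E)) : Prop :=
  ∃ S : ℕ → Set Ω, (∀ n, MeasurableSet (S n)) ∧ Monotone S ∧ (⋃ n, S n) = univ ∧
    ∀ (n : ℕ) (y : Ω →ₘ[μ] E), MemLp y ⊤ μ → ∀ z : Ω →ₘ[μ] E,
      (∀ᵐ ω ∂μ, z ω = (S n).indicator y ω) → z ∈ X

/-- `N` is a norm on `X` (a seminorm that separates points). -/
def IsNorm {X : Submodule ℝ (Ω →ₘ[μ] E)} (N : Seminorm ℝ X) : Prop :=
  ∀ x : X, N x = 0 → x = 0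

/-- The function `xs : Ω → E*` is an element of `X* ∩ L₀(Ω, E*_{σ*})`, and `ℓ` is the element of
`X*` that it defines: `xs` is scalarly measurable (equivalently, `E` being separable, Borel
measurable for the weak star topology), the form `ℓ` on `X` is continuous for the norm `N`, and
`ℓ x = ∫ ⟨xs ω, x ω⟩ dμ`, the integral being convergent, for every `x` in `X`. -/
structure RepresentsDual {X : Submodule ℝ (Ω →ₘ[μ] E)} (N : Seminorm ℝ X)
    (xs : Ω → StrongDual ℝ E) (ℓ : X →ₗ[ℝ] ℝ) : Prop where
  measurable : ∀ e : E, Measurable fun ω => xs ω e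
  continuous : ∃ C : ℝ, ∀ x : X, |ℓ x| ≤ C * N x
  integrable : ∀ x : X, Integrable (fun ω => xs ω ((x : Ω →ₘ[μ] E) ω)) μ
  pairing : ∀ x : X, ℓ x = ∫ ω, xs ω ((x : Ω →ₘ[μ] E) ω) ∂μ

/-- `ℬ` is the integral bornology on `X` associated with the family `φ` of integrands: each `φ i`
is nonnegative with `φ i (·, 0) = 0` (up to a null set of `Ω`), and the members of `ℬ` are exactly
the sets contained in a sublevel set `{x ∈ X : I_{φ i} x ≤ s}`, `s` real, of some `I_{φ i}`. -/
structure IsIntegralBornology {X : Submodule ℝ (Ω →ₘ[μ] E)} (ℬ : Bornology X)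
    {ι : Type*} (φ : ι → Ω → E → EReal) : Prop where
  nonneg : ∀ i, ∀ᵐ ω ∂μ, ∀ e : E, 0 ≤ φ i ω e
  map_zero : ∀ i, ∀ᵐ ω ∂μ, φ i ω 0 = 0
  isBounded_iff : ∀ B : Set X, @Bornology.IsBounded X ℬ B ↔
    ∃ i, ∃ s : ℝ, ∀ x ∈ B, integralFunctional μ (φ i) (x : Ω →ₘ[μ] E) ≤ (s : EReal)

/-- The lower growth condition: for every `i` and `ε > 0` there is a family `(u_r)`, `0 < r < 1`,
of nonnegative functions, integrable for small `r`, with `‖u_r‖₁ → 0` as `r → 0+`, such that for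
small `r`, for almost every `ω` and all `e`,
`[f - ⟨xs, ·⟩](x₀, e, r) ≥ -ε φ i - u_r`. -/
def LowerGrowth (μ : Measure Ω) {ι : Type*} (φ : ι → Ω → E → EReal) (f : Ω → E → EReal)
    (xs : Ω → StrongDual ℝ E) (x₀ : Ω → E) : Prop :=
  ∀ i, ∀ ε : ℝ, 0 < ε → ∃ u : ℝ → Ω → ℝ,
    (∀ r ∈ Ioo (0 : ℝ) 1, ∀ᵐ ω ∂μ, 0 ≤ u r ω) ∧
    (∀ᶠ r in 𝓝[>] (0 : ℝ), Integrable (u r) μ) ∧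
    Tendsto (fun r => eLpNorm (u r) 1 μ) (𝓝[>] 0) (𝓝 0) ∧
    ∀ᶠ r in 𝓝[>] (0 : ℝ), ∀ᵐ ω ∂μ, ∀ e : E,
      -((ε : EReal) * φ i ω e) - ((u r ω : ℝ) : EReal) ≤
        diffQuot (fun e' => f ω e' - ((xs ω e' : ℝ) : EReal)) (x₀ ω) e r

end FunctionSpace

end IntegralSubdiff

end

open MeasureTheory Filter Topology Set

noncomputable section

namespace IntegralSubdiff

/-! Since `I_f` is finite at `x₀`, the function `f(·, x₀(·))` is a.e. equal to an integrable `w`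
with the same integral. Growth implies subderivative by integration: if `p` is an integrable
majorant of `φ i (·, x(·))`, then `w + r (-ε p - u_r + ⟨xs, x⟩)` is an integrable minorant of `f(·,
x₀ + r x)`, and `∫ p` is bounded uniformly on a bounded set.

For the converse, fix `i`, `ε`, `r`, let `q` be the quotient of `f - ⟨xs, ·⟩`, and consider the
excess `(-q - ε φ i)⁺`. The subderivative inequality on `{I_{φ i} ≤ 1}` says that `I_f` has tilted
quotients at least `-δ` there, `δ` being small with `r`. Given any `x`, let `A` be the set where the
excess of `x` is positive; there `q ≤ -ε φ i`. If `φ i (·, x(·))` has integral at most `1` over `A`,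
the inequality at `x 1_A` bounds the integral of the excess by `δ`. Otherwise atomlessness yields `B
⊆ A` over which this integral lies in `[1/2, 1]`, and the inequality at `x 1_B` gives `ε / 2 ≤ δ`,
which is impossible for small `δ` (`lintegral_excess_le`).

So the excess is bounded in mean uniformly over `X`. Decomposability makes the functions obtained
from the various `x` upwards directed, so they have an a.e. upper bound `u_r` of integral at most
that uniform bound (`exists_ae_bound_of_directed`). A measurable selection, truncated by property
`(𝒟)` to lie in `X`, shows that `u_r` dominates the excess for all `e` at almost every `ω`
(`exists_ae_forall_le_of_lintegral_le`). -/

/-! ### Measurable selection on a non-null set -/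

/-- A product measurable set involves only countably many measurable subsets of `Ω`. Recording
membership in them replaces `Ω` by the Cantor space, where descriptive set theory applies. -/
theorem exists_eq_preimage_prodMap {Ω E : Type*} [MeasurableSpace Ω] [MeasurableSpace E]
    {A : Set (Ω × E)} (hA : MeasurableSet A) :
    ∃ h : Ω → ℕ → Bool, Measurable h ∧ ∃ A' : Set ((ℕ → Bool) × E), MeasurableSet A' ∧
      A = Prod.map h id ⁻¹' A' := by
  classical
  induction A, hA using MeasurableSpace.induction_on_inter generateFrom_prod.symm
    isPiSystem_prod with
  | empty => exact ⟨fun _ _ => true, measurable_const, ∅, MeasurableSet.empty, rfl⟩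
  | basic t ht =>
    obtain ⟨s, hs, t, ht, rfl⟩ := ht
    refine ⟨fun ω _ => decide (ω ∈ s), ?_, {z | z 0 = true} ×ˢ t, ?_, ?_⟩
    · refine measurable_pi_lambda _ fun _ => ?_
      exact measurable_to_bool (by simpa [preimage] using hs)
    · refine MeasurableSet.prod ?_ ht
      exact measurable_pi_apply (X := fun _ : ℕ => Bool) 0 (measurableSet_singleton true)
    · ext ⟨ω, e⟩
      simp
  | compl t _ ih =>
    obtain ⟨h, hh, A', hA', rfl⟩ := ih
    exact ⟨h, hh, A'ᶜ, hA'.compl, rfl⟩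
  | iUnion f _ _ ih =>
    choose h hh A' hA' hf using ih
    -- Countably many binary sequences are interleaved into one by the pairing of `ℕ × ℕ` with `ℕ`.
    refine ⟨fun ω k => h k.unpair.1 ω k.unpair.2, ?_,
      ⋃ n, Prod.map (fun z m => z (Nat.pair n m)) id ⁻¹' A' n, ?_, ?_⟩
    · exact measurable_pi_lambda _ fun k => (measurable_pi_apply _).comp (hh _)
    · refine MeasurableSet.iUnion fun n => ?_
      refine Measurable.prodMap ?_ measurable_id (hA' n)
      exact measurable_pi_lambda _ fun m => measurable_pi_apply _
    · rw [preimage_iUnion]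
      refine iUnion_congr fun n => ?_
      rw [hf n]
      ext ⟨ω, e⟩
      simp

/-- A continuous image of the Baire space is inner regular up to compact subsets of the Baire
space (a form of the Choquet capacitability theorem). -/
theorem exists_isCompact_measure_image_ne_zero {Z : Type*} [TopologicalSpace Z]
    [MeasurableSpace Z] (ν : Measure Z) [ν.OuterRegular] {p : (ℕ → ℕ) → Z} (hp : Continuous p)
    (h : ν (range p) ≠ 0) : ∃ K : Set (ℕ → ℕ), IsCompact K ∧ ν (p '' K) ≠ 0 := by
  obtain ⟨c, hc0, hc⟩ := exists_between (pos_iff_ne_zero.2 h)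
  have step : ∀ (k : ℕ) (T : {T : Set (ℕ → ℕ) // c < ν (p '' T)}),
      ∃ m : ℕ, c < ν (p '' (T.1 ∩ {α | α k ≤ m})) := by
    intro k T
    have hU : p '' T.1 = ⋃ m : ℕ, p '' (T.1 ∩ {α | α k ≤ m}) := by
      rw [← image_iUnion, ← inter_iUnion]
      congr 1
      refine (inter_eq_left.2 fun α _ => mem_iUnion.2 ⟨α k, ?_⟩).symm
      simp
    have hmono : Monotone fun m : ℕ => p '' (T.1 ∩ {α | α k ≤ m}) := fun m m' hm =>
      image_mono (inter_subset_inter_right _ fun α (hα : α k ≤ m) => le_trans hα hm)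
    have := T.2
    rw [hU, hmono.measure_iUnion] at this
    exact lt_iSup_iff.1 this
  choose m hm using step
  -- Coordinates are bounded one at a time, keeping the outer measure of the image above `c`.
  -- Continuity from below of outer measure supplies each bound.
  let T : ℕ → {T : Set (ℕ → ℕ) // c < ν (p '' T)} := fun n =>
    Nat.rec ⟨univ, by rwa [image_univ]⟩ (fun k T => ⟨_, hm k T⟩) n
  let a : ℕ → ℕ := fun k => m k (T k)
  have hT : ∀ k, (T k).1 = {α | ∀ i < k, α i ≤ a i} := by
    intro k
    induction k with
    | zero => ext; simp [T]
    | succ k ih =>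
      have : (T (k + 1)).1 = (T k).1 ∩ {α | α k ≤ a k} := rfl
      rw [this, ih]
      ext α
      simp only [mem_inter_iff, mem_ofPred_eq, Nat.lt_succ_iff_lt_or_eq]
      constructor
      · rintro ⟨h1, h2⟩ i (hi | rfl)
        exacts [h1 i hi, h2]
      · exact fun h => ⟨fun i hi => h i (Or.inl hi), h k (Or.inr rfl)⟩
  have hK : IsCompact (univ.pi fun i => Iic (a i)) :=
    isCompact_univ_pi fun i => (Set.finite_Iic (a i)).isCompact
  refine ⟨_, hK, fun h0 => ?_⟩
  -- If the image of the compact box were null, an open `U` of measure below `c` would contain it.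
  -- By compactness `p ⁻¹' U` then contains some `T k`, whose image has measure above `c`.
  obtain ⟨U, hKU, hU, hUc⟩ := Set.exists_isOpen_lt_of_lt (μ := ν) _ c (h0.symm ▸ hc0)
  have hV : IsOpen (p ⁻¹' U) := hU.preimage hp
  have hcyl : ∀ α ∈ univ.pi fun i => Iic (a i), ∃ k, PiNat.cylinder α k ⊆ p ⁻¹' U := by
    intro α hα
    obtain ⟨v, ⟨x, n, rfl⟩, hxv, hv⟩ := (PiNat.isTopologicalBasis_cylinders
      (fun _ : ℕ => ℕ)).exists_subset_of_mem_open (hKU (mem_image_of_mem p hα)) hV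
    exact ⟨n, by rwa [PiNat.mem_cylinder_iff_eq.1 hxv]⟩
  choose! k hk using hcyl
  obtain ⟨t, htK, ht⟩ := hK.elim_nhds_subcover (fun α => PiNat.cylinder α (k α))
    fun α _ => (PiNat.isOpen_cylinder (fun _ : ℕ => ℕ) α (k α)).mem_nhds
      (PiNat.self_mem_cylinder α _)
  have hsub : (T (t.sup k)).1 ⊆ p ⁻¹' U := by
    rw [hT]
    intro β hβ
    -- Replacing the coordinates of `β` from `t.sup k` on by `0` gives a point of the box; the
    -- cylinder covering it sees only earlier coordinates, so it contains `β` too.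
    have : (fun i => if i < t.sup k then β i else 0) ∈ univ.pi fun i => Iic (a i) := by
      intro i _
      by_cases hi : i < t.sup k
      · simpa [hi] using hβ i hi
      · simp [hi]
    obtain ⟨α, hαt, hα⟩ := mem_iUnion₂.1 (ht this)
    refine hk α (htK α hαt) fun i hi => ?_
    have h2 := hα i hi
    have h3 : i < t.sup k := hi.trans_le (Finset.le_sup hαt)
    simpa [h3] using h2
  exact (((T (t.sup k)).2.trans_le (measure_mono (image_subset_iff.2 hsub))).trans hUc).false

/-- A continuous map from a compact set of reals has a measurable section. -/
theorem exists_measurable_section_of_isCompact {Z : Type*} [TopologicalSpace Z] [T2Space Z]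
    [MeasurableSpace Z] [BorelSpace Z] {C : Set ℝ} (hC : IsCompact C) {q : C → Z}
    (hq : Continuous q) :
    ∃ s : Z → ℝ, Measurable s ∧ ∀ z ∈ range q, ∃ t : C, s z = t ∧ q t = z := by
  classical
  have : CompactSpace C := isCompact_iff_compactSpace.1 hC
  have hclosed : ∀ F : Set C, IsClosed F → IsClosed (q '' F) := fun F hF =>
    (hF.isCompact.image hq).isClosed
  -- The section picks the least point of each fibre, so its sublevel sets on the range are images
  -- of compact sets, hence closed.
  have hmin : ∀ z ∈ range q, ∃ t : ℝ, (∃ t' : C, t = t' ∧ q t' = z) ∧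
      ∀ t' : C, q t' = z → t ≤ t' := by
    rintro z ⟨t₀, rfl⟩
    have h1 : IsCompact (q ⁻¹' {q t₀}) := (isClosed_singleton.preimage hq).isCompact
    obtain ⟨t, ht, hmin⟩ := h1.exists_isLeast ⟨t₀, rfl⟩
    exact ⟨t, ⟨t, rfl, ht⟩, fun t' ht' => hmin ht'⟩
  choose! s hs hsmin using hmin
  refine ⟨fun z => if z ∈ range q then s z else 0, ?_, ?_⟩
  · have hR : MeasurableSet (range q) := by
      rw [← image_univ]; exact (hclosed _ isClosed_univ).measurableSet
    refine measurable_of_Iic fun x => ?_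
    have : (fun z => if z ∈ range q then s z else 0) ⁻¹' Iic x =
        (q '' {t : C | (t : ℝ) ≤ x}) ∪ (if 0 ≤ x then (range q)ᶜ else ∅) := by
      ext z
      by_cases hz : z ∈ range q
      · have : z ∉ (if 0 ≤ x then (range q)ᶜ else ∅) := by split_ifs <;> simp [hz]
        simp only [mem_preimage, hz, if_true, mem_Iic, mem_union, this, or_false, mem_image,
          mem_ofPred_eq]
        constructor
        · obtain ⟨t', h1, h2⟩ := hs z hz
          exact fun h => ⟨t', h1 ▸ h, h2⟩
        · rintro ⟨t, ht, htz⟩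
          exact le_trans (hsmin z hz t htz) ht
      · have h1 : z ∉ q '' {t : C | (t : ℝ) ≤ x} := fun ⟨t, _, h⟩ => hz ⟨t, h⟩
        simp only [mem_preimage, hz, if_false, mem_Iic, mem_union, h1, false_or]
        split_ifs with h0 <;> simp [h0, hz]
    rw [this]
    refine (hclosed _ (isClosed_Iic.preimage continuous_subtype_val)).measurableSet.union ?_
    split_ifs
    exacts [hR.compl, MeasurableSet.empty]
  · intro z hz
    simpa [hz] using hs z hz

/-- A weak form of the measurable selection theorem: a product measurable set with non null
projection contains a measurable graph over a measurable set that is not null. -/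
theorem exists_measurable_selection {Ω E : Type*} [MeasurableSpace Ω] (μ : Measure Ω)
    [SFinite μ] [TopologicalSpace E] [PolishSpace E] [MeasurableSpace E] [BorelSpace E]
    {A : Set (Ω × E)} (hA : MeasurableSet A) (h : ¬ ∀ᵐ ω ∂μ, ∀ e, (ω, e) ∉ A) :
    ∃ D : Set Ω, MeasurableSet D ∧ μ D ≠ 0 ∧ ∃ x : Ω → E, Measurable x ∧
      ∀ ω ∈ D, (ω, x ω) ∈ A := by
  classical
  obtain ⟨h', hh', A', hA', rfl⟩ := exists_eq_preimage_prodMap hA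
  have : Nonempty E := by
    by_contra hE
    rw [not_nonempty_iff] at hE
    exact h (Eventually.of_forall fun ω e => isEmptyElim e)
  have : PolishSpace Bool := inferInstance
  let ν : Measure (ℕ → Bool) := (μ.toFinite).map h'
  have hcase : A' = ∅ ∨ ∃ f : (ℕ → ℕ) → (ℕ → Bool) × E, Continuous f ∧ range f = A' := by
    have := hA'.analyticSet
    rwa [AnalyticSet] at this
  obtain rfl | ⟨g, hg, rfl⟩ := hcase
  · exact absurd (by simp) h
  have hpos : ν (range fun α => (g α).1) ≠ 0 := by
    intro h0
    -- The projection need not be Borel, but this inequality for a pushforward holds for every set.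
    have h1 := le_antisymm ((Measure.le_map_apply hh'.aemeasurable _).trans h0.le) (zero_le)
    refine h ?_
    rw [← ae_toFinite (μ := μ)]
    refine measure_mono_null ?_ h1
    intro ω hω
    simp only [mem_compl_iff, mem_ofPred_eq, not_forall, not_not] at hω
    obtain ⟨e, α, hα⟩ := hω
    exact ⟨α, by simp [hα]⟩
  obtain ⟨K, hK, hK0⟩ := exists_isCompact_measure_image_ne_zero ν (continuous_fst.comp hg) hpos
  have hKne : K.Nonempty := by
    by_contra hne
    rw [not_nonempty_iff_eq_empty] at hne
    simp [hne] at hK0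
  have : Nonempty K := hKne.to_subtype
  have : CompactSpace K := isCompact_iff_compactSpace.1 hK
  let _ : MetricSpace K := TopologicalSpace.metrizableSpaceMetric K
  -- Parametrizing `K` by the Cantor set in `ℝ` provides the order needed for the section by least
  -- points.
  obtain ⟨b, hb, hbs⟩ := exists_nat_bool_continuous_surjective_of_compact K
  let q : cantorSet → (ℕ → Bool) × E := fun t => g (b (cantorSetHomeomorphNatToBool t))
  have hq : Continuous q := hg.comp (continuous_subtype_val.comp
    (hb.comp cantorSetHomeomorphNatToBool.continuous))
  have hqr : range (fun t => (q t).1) = (fun α => (g α).1) '' K := by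
    ext z
    constructor
    · rintro ⟨t, rfl⟩
      exact ⟨_, (b (cantorSetHomeomorphNatToBool t)).2, rfl⟩
    · rintro ⟨α, hα, rfl⟩
      obtain ⟨y, hy⟩ := hbs ⟨α, hα⟩
      exact ⟨cantorSetHomeomorphNatToBool.symm y, by simp [q, hy]⟩
  obtain ⟨s, hs, hsec⟩ := exists_measurable_section_of_isCompact isCompact_cantorSet
    (continuous_fst.comp hq)
  have hmR : MeasurableSet (range (fun t => (q t).1)) := by
    rw [hqr]
    exact (hK.image (continuous_fst.comp hg)).isClosed.measurableSet
  refine ⟨h' ⁻¹' range (fun t => (q t).1), hh' hmR, ?_, ?_⟩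
  · intro h0
    apply hK0
    have h1 := Measure.map_apply (μ := μ.toFinite) hh' hmR
    rw [hqr] at h1 h0
    exact h1.trans (toFinite_absolutelyContinuous μ h0)
  · obtain ⟨e₀⟩ := ‹Nonempty E›
    let X : ℝ → E := fun y => if hy : y ∈ cantorSet then (q ⟨y, hy⟩).2 else e₀
    have hX : Measurable X :=
      Measurable.dite (s := cantorSet) (continuous_snd.comp hq).measurable measurable_const
        isClosed_cantorSet.measurableSet
    refine ⟨fun ω => X (s (h' ω)), hX.comp (hs.comp hh'), fun ω hω => ?_⟩
    obtain ⟨t, ht, hqt⟩ := hsec (h' ω) hω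
    refine ⟨b (cantorSetHomeomorphNatToBool t), ?_⟩
    have : X (s (h' ω)) = (q t).2 := by simp [X, ht]
    exact Prod.ext hqt this.symm

/-! ### Upper integrals, atomless measures, essential suprema -/

section MeasureSpace

variable {Ω : Type*} [MeasurableSpace Ω] {μ : Measure Ω}

/-- By σ-finiteness, any value below the integral of `F` is exceeded by that of an integrable simple
function below `F`. -/
theorem lintegral_le_of_forall_integrable_le [SigmaFinite μ] {F : Ω → ENNReal} {c : ENNReal}
    (h : ∀ k : Ω → ℝ, Integrable k μ → (∀ ω, 0 ≤ k ω) → (∀ ω, ENNReal.ofReal (k ω) ≤ F ω) →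
      ENNReal.ofReal (∫ ω, k ω ∂μ) ≤ c) : ∫⁻ ω, F ω ∂μ ≤ c := by
  rw [lintegral_eq_nnreal]
  refine iSup₂_le fun ψ hψ => ?_
  rw [← SimpleFunc.lintegral_eq_lintegral]
  refine le_of_forall_lt fun L hL => ?_
  obtain ⟨g, hgψ, hg, hL⟩ := SimpleFunc.exists_lt_lintegral_simpleFunc_of_lt_lintegral
    (f := ψ) (by simpa using hL)
  have hint : Integrable (fun ω => (g ω : ℝ)) μ := by
    refine ⟨g.measurable.coe_nnreal_real.aestronglyMeasurable, ?_⟩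
    simpa only [hasFiniteIntegral_iff_enorm, NNReal.enorm_eq] using hg
  have := h (fun ω => g ω) hint (fun ω => (g ω).2) fun ω => by
    simpa using (ENNReal.coe_le_coe.2 (hgψ ω)).trans (hψ ω)
  rw [← lintegral_coe_eq_integral _ hint] at this
  exact hL.trans_le this

theorem upperIntegral_le_integral {v : Ω → EReal} {u : Ω → ℝ} (hu : Integrable u μ)
    (h : ∀ᵐ ω ∂μ, v ω ≤ (u ω : EReal)) : upperIntegral μ v ≤ ((∫ ω, u ω ∂μ : ℝ) : EReal) :=
  sInf_le ⟨u, hu, h, rfl⟩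

theorem integral_le_upperIntegral {v : Ω → EReal} {w : Ω → ℝ} (hw : Integrable w μ)
    (h : ∀ᵐ ω ∂μ, (w ω : EReal) ≤ v ω) : ((∫ ω, w ω ∂μ : ℝ) : EReal) ≤ upperIntegral μ v := by
  refine le_sInf ?_
  rintro _ ⟨u, hu, huv, rfl⟩
  refine EReal.coe_le_coe_iff.2 (integral_mono_ae hw hu ?_)
  filter_upwards [h, huv] with ω h1 h2 using EReal.coe_le_coe_iff.1 (h1.trans h2)

theorem exists_integrable_of_upperIntegral_lt {v : Ω → EReal} {c : EReal}
    (h : upperIntegral μ v < c) : ∃ u : Ω → ℝ, Integrable u μ ∧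
      (∀ᵐ ω ∂μ, v ω ≤ (u ω : EReal)) ∧ ((∫ ω, u ω ∂μ : ℝ) : EReal) < c := by
  obtain ⟨_, ⟨u, hu, huv, rfl⟩, hc⟩ := sInf_lt_iff.1 h
  exact ⟨u, hu, huv, hc⟩

/-- A measurable function with finite upper integral is integrable. -/
theorem exists_integrable_eq_of_upperIntegral_finite [SigmaFinite μ] {v : Ω → EReal}
    (hv : Measurable v) (h1 : upperIntegral μ v ≠ ⊤) (h2 : upperIntegral μ v ≠ ⊥) :
    ∃ w : Ω → ℝ, Integrable w μ ∧ (∀ᵐ ω ∂μ, v ω = (w ω : EReal)) ∧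
      upperIntegral μ v = ((∫ ω, w ω ∂μ : ℝ) : EReal) := by
  obtain ⟨u₀, hu₀, hvu₀, -⟩ := exists_integrable_of_upperIntegral_lt h1.lt_top
  obtain ⟨u, hum, huu₀⟩ := hu₀.1.aemeasurable
  have hu : Integrable u μ := hu₀.congr huu₀
  have hvu : ∀ᵐ ω ∂μ, v ω ≤ (u ω : EReal) := by
    filter_upwards [hvu₀, huu₀] with ω h h' using h' ▸ h
  lift upperIntegral μ v to ℝ using ⟨h1, h2⟩ with c hc
  let F : Ω → ENNReal := fun ω => ((u ω : EReal) - v ω).toENNReal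
  have hF : Measurable F :=
    (hum.coe_real_ereal.add (continuous_neg.measurable.comp hv)).ereal_toENNReal
  -- If `0 ≤ k ≤ u - v` with `k` integrable, then `u - k` is still a majorant of `v`, so its
  -- integral is at least `c`.
  have hFint : ∫⁻ ω, F ω ∂μ ≤ ENNReal.ofReal (∫ ω, u ω ∂μ - c) := by
    refine lintegral_le_of_forall_integrable_le fun k hk hk0 hkF => ?_
    refine ENNReal.ofReal_le_ofReal ?_
    have : upperIntegral μ v ≤ ((∫ ω, (u ω - k ω) ∂μ : ℝ) : EReal) := by
      refine upperIntegral_le_integral (hu.sub hk) ?_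
      filter_upwards [hvu] with ω hω
      have := hkF ω
      simp only [F] at this
      induction hvω : v ω with
      | bot => exact bot_le
      | top => rw [hvω] at hω; exact absurd hω (by simp)
      | coe y =>
        rw [hvω] at hω this
        norm_cast at hω this ⊢
        rw [EReal.toENNReal_of_ne_top (EReal.coe_ne_top _), EReal.toReal_coe,
          ENNReal.ofReal_le_ofReal_iff (by linarith)] at this
        linarith
    rw [← hc, integral_sub hu hk] at this
    have := EReal.coe_le_coe_iff.1 this
    linarith
  have hFtop : ∫⁻ ω, F ω ∂μ ≠ ⊤ := (hFint.trans_lt ENNReal.ofReal_lt_top).ne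
  have hw : Integrable (fun ω => u ω - (F ω).toReal) μ :=
    hu.sub (integrable_toReal_of_lintegral_ne_top hF.aemeasurable hFtop)
  have hvw : ∀ᵐ ω ∂μ, v ω = ((u ω - (F ω).toReal : ℝ) : EReal) := by
    filter_upwards [hvu, ae_lt_top hF hFtop] with ω h h'
    simp only [F] at h' ⊢
    induction hvω : v ω with
    | bot => simp [hvω] at h'
    | top => rw [hvω] at h; exact absurd h (by simp)
    | coe y =>
      rw [hvω] at h
      norm_cast at h ⊢
      rw [EReal.toENNReal_of_ne_top (EReal.coe_ne_top _), EReal.toReal_coe,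
        ENNReal.toReal_ofReal (by linarith)]
      ring
  refine ⟨_, hw, hvw, hc.trans (le_antisymm (upperIntegral_le_integral hw ?_)
    (integral_le_upperIntegral hw ?_))⟩
  · exact hvw.mono fun ω h => h.le
  · exact hvw.mono fun ω h => h.ge

/-- In an atomless measure space, the integral of a function takes values between `1 / 2` and `1`
on the subsets of any set over which it exceeds `1`. -/
theorem IsAtomless.exists_setLIntegral_mem_Icc [SigmaFinite μ] (hμ : IsAtomless μ)
    {p : Ω → ENNReal} (hp : Measurable p) {A : Set Ω} (hA : MeasurableSet A)
    (hpA : ∀ᵐ ω ∂μ, ω ∈ A → p ω ≠ ⊤) (h : 1 < ∫⁻ ω in A, p ω ∂μ) :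
    ∃ B ⊆ A, MeasurableSet B ∧ 1 / 2 ≤ ∫⁻ ω in B, p ω ∂μ ∧ ∫⁻ ω in B, p ω ∂μ ≤ 1 := by
  let m : Measure Ω := μ.withDensity p
  have hm : ∀ B, MeasurableSet B → m B = ∫⁻ ω in B, p ω ∂μ := fun B hB => withDensity_apply p hB
  by_contra! hcon
  have hbad : ∀ B ⊆ A, MeasurableSet B → m B ≤ 1 → m B < 1 / 2 := by
    intro B hBA hB hB1
    by_contra! hB2
    rw [hm B hB] at hB1 hB2
    exact (hcon B hBA hB hB2).not_ge hB1
  -- a subset of finite integral, still exceeding `1`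
  obtain ⟨C, hCA, hC, hC1, hCtop⟩ : ∃ C ⊆ A, MeasurableSet C ∧ 1 < m C ∧ m C ≠ ⊤ := by
    -- These sets have finite `m`-measure and exhaust `A` up to a null set, because `p` is a.e.
    -- finite on `A`.
    let C : ℕ → Set Ω := fun n => A ∩ (spanningSets μ n ∩ {ω | p ω ≤ n})
    have hCm : ∀ n, MeasurableSet (C n) := fun n =>
      hA.inter ((measurableSet_spanningSets μ n).inter (measurableSet_le hp measurable_const))
    have hmono : Monotone C := by
      intro n n' hn ω hω
      exact ⟨hω.1, monotone_spanningSets μ hn hω.2.1,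
        le_trans (show p ω ≤ n from hω.2.2) (Nat.cast_le.2 hn)⟩
    have hU : m (⋃ n, C n) = m A := by
      refine measure_congr ((LE.le.eventuallyLE
        (iUnion_subset fun n => inter_subset_left)).antisymm ?_)
      refine (withDensity_absolutelyContinuous μ p).ae_le ?_
      filter_upwards [hpA] with ω hω hωA
      obtain ⟨n₁, hn₁⟩ := mem_iUnion.1 ((iUnion_spanningSets μ).symm ▸ mem_univ ω :
        ω ∈ ⋃ n, spanningSets μ n)
      obtain ⟨n₂, hn₂⟩ := ENNReal.exists_nat_gt (hω hωA)
      exact mem_iUnion.2 ⟨max n₁ n₂, hωA, monotone_spanningSets μ (le_max_left _ _) hn₁,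
        hn₂.le.trans (Nat.cast_le.2 (le_max_right _ _))⟩
    rw [← hm A hA, ← hU, hmono.measure_iUnion] at h
    obtain ⟨n, hn⟩ := lt_iSup_iff.1 h
    refine ⟨C n, inter_subset_left, hCm n, hn, ?_⟩
    rw [hm _ (hCm n)]
    refine ((setLIntegral_mono measurable_const fun ω hω => hω.2.2).trans_lt
      (b := ∫⁻ _ in C n, (n : ENNReal) ∂μ) ?_).ne
    rw [setLIntegral_const]
    refine ENNReal.mul_lt_top (ENNReal.natCast_lt_top n) (lt_of_le_of_lt (measure_mono ?_)
      (measure_spanningSets_lt_top μ n))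
    exact fun ω hω => hω.2.1
  -- a maximal small subset of `C`
  let 𝒮 : Set ENNReal := {t | ∃ D ⊆ C, MeasurableSet D ∧ m D < 1 / 2 ∧ m D = t}
  obtain ⟨t, -, htlim, ht⟩ := exists_seq_tendsto_sSup (S := 𝒮)
    ⟨0, ∅, empty_subset _, MeasurableSet.empty, by simp, by simp⟩ (OrderTop.bddAbove _)
  choose D hDC hDm hD htD using ht
  have hunion : ∀ B ⊆ C, MeasurableSet B → ∀ B' ⊆ C, MeasurableSet B' → m B < 1 / 2 →
      m B' < 1 / 2 → m (B ∪ B') < 1 / 2 := by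
    intro B hBC hB B' hBC' hB' h1 h2
    refine hbad _ ((union_subset hBC hBC').trans hCA) (hB.union hB') ?_
    refine (measure_union_le _ _).trans ((add_le_add h1.le h2.le).trans ?_)
    rw [ENNReal.add_halves]
  have hacc : ∀ n, accumulate D n ⊆ C ∧ MeasurableSet (accumulate D n) ∧
      m (accumulate D n) < 1 / 2 := by
    intro n
    induction n with
    | zero => simpa using ⟨hDC 0, hDm 0, by simpa using hD 0⟩
    | succ n ih =>
      rw [accumulate_succ]
      exact ⟨union_subset ih.1 (hDC _), ih.2.1.union (hDm _),
        hunion _ ih.1 ih.2.1 _ (hDC _) (hDm _) ih.2.2 (hD _)⟩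
  let M : Set Ω := ⋃ n, D n
  have hMC : M ⊆ C := iUnion_subset hDC
  have hMm : MeasurableSet M := MeasurableSet.iUnion hDm
  have hM : m M < 1 / 2 := by
    refine hbad M (hMC.trans hCA) hMm ?_
    have : m M = ⨆ n, m (accumulate D n) := by
      rw [← monotone_accumulate.measure_iUnion, iUnion_accumulate]
    rw [this]
    exact iSup_le fun n => (hacc n).2.2.le.trans (by simp)
  have hMmax : sSup 𝒮 ≤ m M := le_of_tendsto' htlim fun n => by
    rw [← htD n]
    exact measure_mono (subset_iUnion D n)
  have hnull : ∀ E ⊆ C \ M, MeasurableSet E → m E ≠ 0 → 1 < m E := by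
    intro E hE hEm hE0
    by_contra! hE1
    have hEC : E ⊆ C := hE.trans sdiff_subset
    have h1 := hbad E (hEC.trans hCA) hEm hE1
    have h2 := hunion M hMC hMm E hEC hEm hM h1
    have h3 : m (M ∪ E) ≤ m M :=
      (le_sSup (show m (M ∪ E) ∈ 𝒮 from
        ⟨_, union_subset hMC hEC, hMm.union hEm, h2, rfl⟩)).trans hMmax
    rw [measure_union (disjoint_sdiff_right.mono_right hE) hEm] at h3
    have hMtop : m M ≠ ⊤ := (hM.trans_le le_top).ne
    refine hE0 (le_antisymm ?_ (zero_le))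
    exact (ENNReal.add_le_add_iff_left hMtop).1 (by simpa using h3)
  -- nonnull sets split into two nonnull pieces
  have hsplit : ∀ E, MeasurableSet E → m E ≠ 0 →
      ∃ B ⊆ E, MeasurableSet B ∧ m B ≠ 0 ∧ m (E \ B) ≠ 0 := by
    intro E hE hE0
    have hsupp : MeasurableSet {ω | p ω ≠ 0} := hp (measurableSet_singleton 0).compl
    rw [Ne, withDensity_apply_eq_zero hp] at hE0
    obtain ⟨B, hB, hBE, hB0, hB1⟩ := hμ _ (hsupp.inter hE) hE0
    refine ⟨B, hBE.trans inter_subset_right, hB, ?_, ?_⟩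
    · rw [Ne, withDensity_apply_eq_zero hp, inter_eq_self_of_subset_right]
      · exact hB0
      · exact hBE.trans inter_subset_left
    · rw [Ne, withDensity_apply_eq_zero hp, ← inter_sdiff_assoc]
      exact hB1
  -- Each non-null subset of `C \ M` has measure above `1` and splits into two such sets. Iterating
  -- makes its measure infinite, against the finiteness of `m C`.
  have hlarge : ∀ n : ℕ, ∀ E ⊆ C \ M, MeasurableSet E → m E ≠ 0 → (n : ENNReal) ≤ m E := by
    intro n
    induction n with
    | zero => simp
    | succ n ih =>
      intro E hE hEm hE0
      obtain ⟨B, hBE, hB, hB0, hB1⟩ := hsplit E hEm hE0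
      have h1 := ih B (hBE.trans hE) hB hB0
      have h2 := hnull (E \ B) (sdiff_subset.trans hE) (hEm.diff hB) hB1
      have h3 : m E = m B + m (E \ B) := by
        rw [measure_add_sdiff hB.nullMeasurableSet E, union_eq_self_of_subset_left hBE]
      rw [h3]
      push_cast
      exact add_le_add h1 h2.le
  have hCM : m (C \ M) ≠ 0 := by
    intro h0
    have : m C ≤ m M := by
      rw [← sdiff_union_of_subset hMC]
      exact (measure_union_le _ _).trans (by simp [h0])
    exact absurd (hC1.trans_le (this.trans hM.le)) (by simp)
  obtain ⟨n, hn⟩ := ENNReal.exists_nat_gt hCtop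
  exact ((hlarge n _ subset_rfl (hC.diff hMm) hCM).trans (measure_mono sdiff_subset)).not_gt hn

/-- The essential supremum of an upwards directed family of functions, when their integrals are
bounded. -/
theorem exists_ae_bound_of_directed {𝒱 : Set (Ω → ENNReal)} (hne : 𝒱.Nonempty)
    (hm : ∀ v ∈ 𝒱, Measurable v)
    (hdir : ∀ v ∈ 𝒱, ∀ v' ∈ 𝒱, ∃ v'' ∈ 𝒱, ∀ᵐ ω ∂μ, max (v ω) (v' ω) ≤ v'' ω) {c : ENNReal}
    (hc : c ≠ ⊤) (hle : ∀ v ∈ 𝒱, ∫⁻ ω, v ω ∂μ ≤ c) :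
    ∃ u : Ω → ENNReal, Measurable u ∧ ∫⁻ ω, u ω ∂μ ≤ c ∧ ∀ v ∈ 𝒱, ∀ᵐ ω ∂μ, v ω ≤ u ω := by
  obtain ⟨t, -, htlim, ht⟩ := exists_seq_tendsto_sSup (S := (fun v => ∫⁻ ω, v ω ∂μ) '' 𝒱)
    (hne.image _) (OrderTop.bddAbove _)
  choose v hv𝒱 hvt using ht
  choose! s hs𝒱 hs using hdir
  let V : ℕ → Ω → ENNReal := fun n => Nat.rec (v 0) (fun k V => s V (v (k + 1))) n
  have hV𝒱 : ∀ n, V n ∈ 𝒱 := by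
    intro n
    induction n with
    | zero => exact hv𝒱 0
    | succ n ih => exact hs𝒱 _ ih _ (hv𝒱 _)
  have hVmono : ∀ n, ∀ᵐ ω ∂μ, V n ω ≤ V n.succ ω := fun n =>
    (hs _ (hV𝒱 n) _ (hv𝒱 (n + 1))).mono fun ω hω => (le_max_left _ _).trans hω
  have hvV : ∀ n, ∀ᵐ ω ∂μ, v n ω ≤ V n ω := by
    intro n
    cases n with
    | zero => exact Eventually.of_forall fun ω => le_rfl
    | succ n =>
      exact (hs _ (hV𝒱 n) _ (hv𝒱 (n + 1))).mono fun ω hω => (le_max_right _ _).trans hω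
  have hu : Measurable fun ω => ⨆ n, V n ω := Measurable.iSup fun n => hm _ (hV𝒱 n)
  have hint : ∫⁻ ω, ⨆ n, V n ω ∂μ = ⨆ n, ∫⁻ ω, V n ω ∂μ :=
    lintegral_iSup_ae (fun n => hm _ (hV𝒱 n)) hVmono
  have hsup : sSup ((fun v => ∫⁻ ω, v ω ∂μ) '' 𝒱) ≤ ∫⁻ ω, ⨆ n, V n ω ∂μ := by
    refine le_of_tendsto' htlim fun n => ?_
    rw [← hvt n, hint]
    exact (lintegral_mono_ae (hvV n)).trans (le_iSup (fun n => ∫⁻ ω, V n ω ∂μ) n)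
  have hle' : ∫⁻ ω, ⨆ n, V n ω ∂μ ≤ c := hint.trans_le (iSup_le fun n => hle _ (hV𝒱 n))
  refine ⟨_, hu, hle', fun w hw => ?_⟩
  have hint' : ∫⁻ ω, ⨆ n, max (V n ω) (w ω) ∂μ = ⨆ n, ∫⁻ ω, max (V n ω) (w ω) ∂μ :=
    lintegral_iSup_ae (fun n => (hm _ (hV𝒱 n)).max (hm _ hw))
      fun n => (hVmono n).mono fun ω hω => max_le_max_right _ hω
  -- The increasing sequence already attains the supremum of the integrals, so adjoining `w` cannot
  -- increase the integral; finiteness then forces a.e. equality.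
  have h1 : ∫⁻ ω, ⨆ n, max (V n ω) (w ω) ∂μ ≤ ∫⁻ ω, ⨆ n, V n ω ∂μ := by
    rw [hint']
    refine iSup_le fun n => ?_
    refine (lintegral_mono_ae (hs _ (hV𝒱 n) _ hw)).trans (le_trans ?_ hsup)
    exact le_sSup ⟨_, hs𝒱 _ (hV𝒱 n) _ hw, rfl⟩
  have h2 := ae_eq_of_ae_le_of_lintegral_le
    (Eventually.of_forall fun ω => iSup_mono fun n => le_max_left (V n ω) (w ω))
    (hle'.trans_lt hc.lt_top).ne
    (Measurable.iSup fun n => (hm _ (hV𝒱 n)).max (hm _ hw)).aemeasurable h1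
  filter_upwards [h2] with ω hω
  rw [hω]
  exact (le_max_right (V 0 ω) (w ω)).trans (le_iSup (fun n => max (V n ω) (w ω)) 0)

end MeasureSpace

/-! ### Difference quotients with extended real values -/

/-- Comparison with real constants trades extended arithmetic for real arithmetic; infinite `F` is
allowed since multiplying by `r⁻¹ > 0` preserves both infinities. -/
theorem coe_le_inv_mul_sub_iff {r : ℝ} (hr : 0 < r) (F : EReal) (w c : ℝ) :
    (c : EReal) ≤ ((r⁻¹ : ℝ) : EReal) * (F - (w : EReal)) ↔ ((w + r * c : ℝ) : EReal) ≤ F := by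
  induction F with
  | bot =>
    generalize w + r * c = d
    simp [EReal.coe_mul_bot_of_pos (inv_pos.2 hr)]
  | top =>
    generalize w + r * c = d
    simp [EReal.coe_mul_top_of_pos (inv_pos.2 hr)]
  | coe y =>
    rw [← EReal.coe_sub, ← EReal.coe_mul, EReal.coe_le_coe_iff, EReal.coe_le_coe_iff,
      inv_mul_eq_div, le_div_iff₀ hr]
    constructor <;> intro h <;> linarith

theorem inv_mul_sub_le_coe_iff {r : ℝ} (hr : 0 < r) (F : EReal) (w c : ℝ) :
    ((r⁻¹ : ℝ) : EReal) * (F - (w : EReal)) ≤ (c : EReal) ↔ F ≤ ((w + r * c : ℝ) : EReal) := by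
  induction F with
  | bot =>
    generalize w + r * c = d
    simp [EReal.coe_mul_bot_of_pos (inv_pos.2 hr)]
  | top =>
    generalize w + r * c = d
    simp [EReal.coe_mul_top_of_pos (inv_pos.2 hr)]
  | coe y =>
    rw [← EReal.coe_sub, ← EReal.coe_mul, EReal.coe_le_coe_iff, EReal.coe_le_coe_iff,
      inv_mul_eq_div, div_le_iff₀ hr]
    constructor <;> intro h <;> linarith

theorem coe_le_diffQuot_sub_iff {V : Type*} [AddCommGroup V] [Module ℝ V] {F : V → EReal}
    {x₀ x : V} {r w : ℝ} (hr : 0 < r) (hw : F x₀ = (w : EReal)) (c l : ℝ) :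
    (c : EReal) ≤ diffQuot F x₀ x r - (l : EReal) ↔
      ((w + r * (c + l) : ℝ) : EReal) ≤ F (x₀ + r • x) := by
  rw [EReal.le_sub_iff_add_le (by simp) (by simp), ← EReal.coe_add, diffQuot, hw,
    coe_le_inv_mul_sub_iff hr]

theorem diffQuot_sub_linear {V : Type*} [AddCommGroup V] [Module ℝ V] {F : V → EReal}
    {x₀ x : V} {r w : ℝ} (hw : F x₀ = (w : EReal)) (L : V →ₗ[ℝ] ℝ) :
    diffQuot (fun e => F e - ((L e : ℝ) : EReal)) x₀ x r =
      ((r⁻¹ : ℝ) : EReal) * (F (x₀ + r • x) - ((w + r * L x : ℝ) : EReal)) := by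
  simp only [diffQuot, hw]
  congr 1
  rw [map_add, map_smul, smul_eq_mul]
  induction F (x₀ + r • x) with
  | bot => simp
  | top => norm_cast
  | coe y =>
    norm_cast
    ring

section FunctionSpace

variable {Ω E : Type*} [NormedAddCommGroup E] [NormedSpace ℝ E]

/-- The differential quotient at `x₀` of the integrand `f - ⟨xs, ·⟩`. -/
def tiltedQuot (f : Ω → E → EReal) (xs : Ω → StrongDual ℝ E) (x₀ : Ω → E) (r : ℝ) (ω : Ω)
    (e : E) : EReal :=
  diffQuot (fun e' => f ω e' - ((xs ω e' : ℝ) : EReal)) (x₀ ω) e r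

section Pointwise

variable {f : Ω → E → EReal} {xs : Ω → StrongDual ℝ E} {x₀ : Ω → E} {r : ℝ} {ω : Ω} {w : ℝ}

theorem coe_le_tiltedQuot_iff (hr : 0 < r) (hw : f ω (x₀ ω) = (w : EReal)) (e : E) (c : ℝ) :
    (c : EReal) ≤ tiltedQuot f xs x₀ r ω e ↔
      ((w + r * (c + xs ω e) : ℝ) : EReal) ≤ f ω (x₀ ω + r • e) := by
  have := diffQuot_sub_linear (x := e) (r := r) hw (xs ω : E →ₗ[ℝ] ℝ)
  simp only [ContinuousLinearMap.coe_coe] at this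
  rw [tiltedQuot, this, coe_le_inv_mul_sub_iff hr]
  ring_nf

theorem tiltedQuot_le_coe_iff (hr : 0 < r) (hw : f ω (x₀ ω) = (w : EReal)) (e : E) (c : ℝ) :
    tiltedQuot f xs x₀ r ω e ≤ (c : EReal) ↔
      f ω (x₀ ω + r • e) ≤ ((w + r * (c + xs ω e) : ℝ) : EReal) := by
  have := diffQuot_sub_linear (x := e) (r := r) hw (xs ω : E →ₗ[ℝ] ℝ)
  simp only [ContinuousLinearMap.coe_coe] at this
  rw [tiltedQuot, this, inv_mul_sub_le_coe_iff hr]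
  ring_nf

theorem tiltedQuot_zero (hw : f ω (x₀ ω) = (w : EReal)) : tiltedQuot f xs x₀ r ω 0 = 0 := by
  have := diffQuot_sub_linear (x := 0) (r := r) hw (xs ω : E →ₗ[ℝ] ℝ)
  simp only [ContinuousLinearMap.coe_coe] at this
  rw [tiltedQuot, this]
  simp only [smul_zero, add_zero, hw, map_zero, mul_zero]
  rw [← EReal.coe_sub]
  simp

end Pointwise

/-! ### Decomposable function spaces -/

section FunctionClasses

variable [MeasurableSpace Ω] {μ : Measure Ω} {X : Submodule ℝ (Ω →ₘ[μ] E)}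

theorem coeFn_add_smul (x₀ x : X) (r : ℝ) :
    ∀ᵐ ω ∂μ, ((x₀ + r • x : X) : Ω →ₘ[μ] E) ω =
      (x₀ : Ω →ₘ[μ] E) ω + r • (x : Ω →ₘ[μ] E) ω := by
  filter_upwards [AEEqFun.coeFn_add (x₀ : Ω →ₘ[μ] E) (r • (x : Ω →ₘ[μ] E)),
    AEEqFun.coeFn_smul r (x : Ω →ₘ[μ] E)] with ω h1 h2
  simp [h1, h2]

theorem Decomposable.exists_piecewise (hdec : Decomposable X) (x y : X) {A : Set Ω}
    (hA : MeasurableSet A) : ∃ z : X, (∀ᵐ ω ∂μ, ω ∈ A → (z : Ω →ₘ[μ] E) ω = (x : Ω →ₘ[μ] E) ω) ∧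
      ∀ᵐ ω ∂μ, ω ∉ A → (z : Ω →ₘ[μ] E) ω = (y : Ω →ₘ[μ] E) ω := by
  have hm : AEStronglyMeasurable (A.indicator (x : Ω →ₘ[μ] E) + Aᶜ.indicator (y : Ω →ₘ[μ] E)) μ :=
    ((x : Ω →ₘ[μ] E).aestronglyMeasurable.indicator hA).add
      ((y : Ω →ₘ[μ] E).aestronglyMeasurable.indicator hA.compl)
  have h := AEEqFun.coeFn_mk _ hm
  refine ⟨⟨AEEqFun.mk _ hm, hdec x x.2 y y.2 A hA _ (h.mono fun ω hω => hω)⟩,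
    h.mono fun ω hω hωA => ?_, h.mono fun ω hω hωA => ?_⟩
  · simpa [hωA] using hω
  · simpa [hωA] using hω

theorem Decomposable.exists_indicator (hdec : Decomposable X) (x : X) {A : Set Ω}
    (hA : MeasurableSet A) : ∃ z : X, ∀ᵐ ω ∂μ, (ω ∈ A → (z : Ω →ₘ[μ] E) ω = (x : Ω →ₘ[μ] E) ω) ∧
      (ω ∉ A → (z : Ω →ₘ[μ] E) ω = 0) := by
  obtain ⟨z, h1, h2⟩ := hdec.exists_piecewise x 0 hA
  refine ⟨z, ?_⟩
  filter_upwards [h1, h2, AEEqFun.coeFn_zero (α := Ω) (μ := μ) (β := E)] with ω h1 h2 h3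
  exact ⟨h1, fun h => (h2 h).trans h3⟩

omit [NormedSpace ℝ E] in
theorem measurable_apply_coeFn [SecondCountableTopology E] [MeasurableSpace E] [BorelSpace E]
    {α : Type*} [MeasurableSpace α] {W : Ω → E → α} (hW : Measurable (Function.uncurry W))
    (x : Ω →ₘ[μ] E) : Measurable fun ω => W ω (x ω) :=
  hW.comp (measurable_id.prodMk x.measurable)

/-- If the integrals of `W(·, x(·))`, `x` in `X`, are bounded, then `W` has an integrable bound
which does not depend on `e`. -/
theorem exists_ae_forall_le_of_lintegral_le [SigmaFinite μ] [CompleteSpace E]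
    [TopologicalSpace.SeparableSpace E] [MeasurableSpace E] [BorelSpace E]
    (hdec : Decomposable X) (hD : PropertyD X) {W : Ω → E → ENNReal}
    (hW : Measurable (Function.uncurry W)) {c : ENNReal} (hc : c ≠ ⊤)
    (h : ∀ x : X, ∫⁻ ω, W ω ((x : Ω →ₘ[μ] E) ω) ∂μ ≤ c) :
    ∃ u : Ω → ENNReal, Measurable u ∧ ∫⁻ ω, u ω ∂μ ≤ c ∧ ∀ᵐ ω ∂μ, ∀ e, W ω e ≤ u ω := by
  have : SecondCountableTopology E := UniformSpace.secondCountable_of_separable E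
  have hWm : ∀ x : Ω →ₘ[μ] E, Measurable fun ω => W ω (x ω) := 
    measurable_apply_coeFn hW
  obtain ⟨u, hu, huc, hle⟩ := exists_ae_bound_of_directed (μ := μ)
    (𝒱 := range fun (x : X) ω => W ω ((x : Ω →ₘ[μ] E) ω)) ⟨_, mem_range_self 0⟩
    (by rintro _ ⟨x, rfl⟩; exact hWm x) (by
      rintro _ ⟨x, rfl⟩ _ ⟨y, rfl⟩
      obtain ⟨z, h1, h2⟩ := hdec.exists_piecewise x y (measurableSet_le (hWm y) (hWm x))
      refine ⟨_, ⟨z, rfl⟩, ?_⟩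
      filter_upwards [h1, h2] with ω h1 h2
      by_cases hω : W ω ((y : Ω →ₘ[μ] E) ω) ≤ W ω ((x : Ω →ₘ[μ] E) ω)
      · simp only [h1 hω, max_eq_left hω, le_refl]
      · simp only [h2 hω, max_eq_right (not_le.1 hω).le, le_refl])
    hc (by rintro _ ⟨x, rfl⟩; exact h x)
  refine ⟨u, hu, huc, ?_⟩
  by_contra hcon
  obtain ⟨D, hDm, hD0, x, hx, hxD⟩ := exists_measurable_selection μ
    (A := {p : Ω × E | u p.1 < Function.uncurry W p})
    (measurableSet_lt (hu.comp measurable_fst) hW) (by simpa using hcon)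
  obtain ⟨S, hS, hSmono, hSU, hSX⟩ := hD
  -- Cutting the selection down to `S n` and to norm at most `n` puts it in `X`; some such cut is
  -- still non-null on `D`.
  obtain ⟨n, hn⟩ : ∃ n : ℕ, μ (D ∩ (S n ∩ {ω | ‖x ω‖ ≤ n})) ≠ 0 := by
    by_contra! hall
    refine hD0 (measure_mono_null ?_ (measure_iUnion_null hall))
    intro ω hω
    obtain ⟨n₁, hn₁⟩ := mem_iUnion.1 (hSU.symm ▸ mem_univ ω : ω ∈ ⋃ n, S n)
    obtain ⟨n₂, hn₂⟩ := exists_nat_ge ‖x ω‖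
    exact mem_iUnion.2 ⟨max n₁ n₂, hω, hSmono (le_max_left _ _) hn₁,
      hn₂.trans (Nat.cast_le.2 (le_max_right _ _))⟩
  have hbm : MeasurableSet {ω | ‖x ω‖ ≤ n} := measurableSet_le hx.norm measurable_const
  have hym : AEStronglyMeasurable ({ω | ‖x ω‖ ≤ n}.indicator x) μ :=
    (hx.indicator hbm).aestronglyMeasurable
  have hzm : AEStronglyMeasurable ((S n).indicator (AEEqFun.mk _ hym)) μ :=
    (AEEqFun.aestronglyMeasurable _).indicator (hS n)
  have hz : AEEqFun.mk _ hzm ∈ X := by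
    refine hSX n (AEEqFun.mk _ hym) ?_ _ (AEEqFun.coeFn_mk _ hzm)
    refine memLp_top_of_bound (AEEqFun.aestronglyMeasurable _) n ?_
    filter_upwards [AEEqFun.coeFn_mk _ hym] with ω hω
    rw [hω]
    by_cases hxn : ‖x ω‖ ≤ n
    · simp [indicator, hxn]
    · simp [indicator, hxn]
  refine hn ?_
  have hmain : ∀ᵐ ω ∂μ, ω ∉ D ∩ (S n ∩ {ω | ‖x ω‖ ≤ n}) := by
    filter_upwards [hle _ ⟨⟨_, hz⟩, rfl⟩, AEEqFun.coeFn_mk _ hzm, AEEqFun.coeFn_mk _ hym]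
      with ω h1 h2 h3 h4
    have h5 : AEEqFun.mk _ hzm ω = x ω := by
      rw [h2, indicator_of_mem h4.2.1, h3, indicator_of_mem h4.2.2]
    simp only [h5] at h1
    exact (hxD ω h4.1).not_ge h1
  exact measure_eq_zero_iff_ae_notMem.2 hmain

end FunctionClasses

end FunctionSpace

/-! ### The two implications -/

section FunctionSpace

variable {Ω E : Type*} [MeasurableSpace Ω] {μ : Measure Ω}
  [NormedAddCommGroup E] [NormedSpace ℝ E] {X : Submodule ℝ (Ω →ₘ[μ] E)} {N : Seminorm ℝ X}
  {ι : Type*} {φ : ι → Ω → E → EReal} {ℬ : Bornology X} {f : Ω → E → EReal} {x₀ : X}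
  {xs : Ω → StrongDual ℝ E} {ℓ : X →ₗ[ℝ] ℝ} {w : Ω → ℝ}

theorem LowerGrowth.zero_le_liminf (hℬ : IsIntegralBornology ℬ φ) (hw : Integrable w μ)
    (hfw : ∀ᵐ ω ∂μ, f ω ((x₀ : Ω →ₘ[μ] E) ω) = (w ω : EReal))
    (hI : integralFunctional μ f (x₀ : Ω →ₘ[μ] E) = ((∫ ω, w ω ∂μ : ℝ) : EReal))
    (hxs : RepresentsDual N xs ℓ) (h : LowerGrowth μ φ f xs (x₀ : Ω →ₘ[μ] E)) {B : Set X}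
    (hB : @Bornology.IsBounded X ℬ B) :
    0 ≤ liminf (fun r : ℝ => ⨅ x ∈ B,
      (diffQuot (fun x : X => integralFunctional μ f (x : Ω →ₘ[μ] E)) x₀ x r -
        ((ℓ x : ℝ) : EReal))) (𝓝[>] 0) := by
  obtain ⟨i, s, hs⟩ := (hℬ.isBounded_iff B).1 hB
  refine le_of_forall_lt fun a ha => ?_
  obtain ⟨d, had, hd⟩ := EReal.lt_iff_exists_real_btwn.1 ha
  have hd0 : d < 0 := by exact_mod_cast hd
  refine had.trans_le (le_liminf_of_le (by isBoundedDefault) ?_)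
  have hs0 : 0 < |s| + 1 := by positivity
  -- Chosen so that `ε ∫ p ≤ -d / 2`, the other half of `-d` being left for `u r`. The `+ 1` leaves
  -- room for a majorant `p` whose integral may exceed `s`.
  set ε : ℝ := -d / (2 * (|s| + 1)) with hε
  have hε0 : 0 < ε := div_pos (by linarith) (by linarith)
  obtain ⟨u, hu0, hui, hulim, hgr⟩ := h i ε hε0
  have hlt := hulim.eventually (gt_mem_nhds
    (show (0 : ENNReal) < ENNReal.ofReal (-d / 2) from ENNReal.ofReal_pos.2 (by linarith)))
  filter_upwards [hui, hlt, hgr, Ioo_mem_nhdsGT zero_lt_one] with r hur hr2 hr3 hr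
  have hrpos : 0 < r := hr.1
  refine le_iInf₂ fun x hx => ?_
  refine (coe_le_diffQuot_sub_iff
    (F := fun x : X => integralFunctional μ f (x : Ω →ₘ[μ] E)) hrpos hI _ _).2 ?_
  have hu1 : ∫ ω, u r ω ∂μ ≤ -d / 2 := by
    rw [eLpNorm_one_eq_lintegral_enorm] at hr2
    have : ENNReal.ofReal (∫ ω, u r ω ∂μ) ≤ ∫⁻ ω, ‖u r ω‖ₑ ∂μ := by
      rw [ofReal_integral_eq_lintegral_ofReal hur (hu0 r hr)]
      exact lintegral_mono fun ω => Real.ofReal_le_enorm _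
    exact (ENNReal.ofReal_le_ofReal_iff (by linarith)).1 (this.trans hr2.le)
  obtain ⟨p, hp, hpφ, hpint⟩ := exists_integrable_of_upperIntegral_lt
    ((hs x hx).trans_lt (EReal.coe_lt_coe_iff.2 (lt_of_le_of_lt (le_abs_self s) (lt_add_one _))))
  have hpint' : ∫ ω, p ω ∂μ < |s| + 1 := by exact_mod_cast hpint
  have hxi := hxs.integrable x
  have hpn : Integrable (fun ω => -(ε * p ω)) μ := (hp.const_mul ε).neg
  have hpu : Integrable (fun ω => -(ε * p ω) - u r ω) μ := hpn.sub hur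
  have hpi : Integrable (fun ω => -(ε * p ω) - u r ω + xs ω ((x : Ω →ₘ[μ] E) ω)) μ :=
    hpu.add hxi
  have hint : ∫ ω, (w ω + r * (-(ε * p ω) - u r ω + xs ω ((x : Ω →ₘ[μ] E) ω))) ∂μ =
      ∫ ω, w ω ∂μ + r * (-(ε * ∫ ω, p ω ∂μ) - ∫ ω, u r ω ∂μ + ℓ x) := by
    rw [integral_add hw (hpi.const_mul r), integral_const_mul,
      integral_add hpu hxi, integral_sub hpn hur,
      integral_neg, integral_const_mul, hxs.pairing]
  have hle := integral_le_upperIntegral (hw.add (hpi.const_mul r))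
    (v := fun ω => f ω (((x₀ + r • x : X) : Ω →ₘ[μ] E) ω)) (by
      filter_upwards [hfw, hr3, hpφ, coeFn_add_smul x₀ x r] with ω h1 h2 h3 h4
      rw [h4]
      refine (coe_le_tiltedQuot_iff hrpos h1 _ _).1 (le_trans ?_ (h2 _))
      rw [EReal.coe_sub, EReal.coe_neg, EReal.coe_mul]
      refine EReal.sub_le_sub (EReal.neg_le_neg_iff.2 ?_) le_rfl
      exact mul_le_mul_of_nonneg_left h3 (EReal.coe_nonneg.2 hε0.le))
  refine le_trans ?_ hle
  simp only [Pi.add_apply]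
  rw [hint, EReal.coe_le_coe_iff]
  have h1 : ε * ∫ ω, p ω ∂μ ≤ -d / 2 := by
    refine (mul_le_mul_of_nonneg_left hpint'.le hε0.le).trans_eq ?_
    rw [hε]
    field_simp
  have h2 : d + ℓ x ≤ -(ε * ∫ ω, p ω ∂μ) - ∫ ω, u r ω ∂μ + ℓ x := by linarith
  have := mul_le_mul_of_nonneg_left h2 hrpos.le
  linarith

/-- The function `w + r (-k + ⟨xs, x⟩)` is an integrable majorant of `f(·, x₀ + r x)`, which bounds
the quotient of `I_f` from above. -/
theorem integral_le_of_tiltedQuot_le_neg {r δ : ℝ} (hr : 0 < r) (hw : Integrable w μ)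
    (hfw : ∀ᵐ ω ∂μ, f ω ((x₀ : Ω →ₘ[μ] E) ω) = (w ω : EReal))
    (hI : integralFunctional μ f (x₀ : Ω →ₘ[μ] E) = ((∫ ω, w ω ∂μ : ℝ) : EReal))
    (hxs : RepresentsDual N xs ℓ) {x : X}
    (hδ : ((-δ : ℝ) : EReal) ≤ diffQuot (fun x : X => integralFunctional μ f (x : Ω →ₘ[μ] E))
      x₀ x r - ((ℓ x : ℝ) : EReal)) {k : Ω → ℝ} (hk : Integrable k μ)
    (hkx : ∀ᵐ ω ∂μ, tiltedQuot f xs (x₀ : Ω →ₘ[μ] E) r ω ((x : Ω →ₘ[μ] E) ω) ≤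
      ((-k ω : ℝ) : EReal)) : ∫ ω, k ω ∂μ ≤ δ := by
  replace hδ := (coe_le_diffQuot_sub_iff
    (F := fun x : X => integralFunctional μ f (x : Ω →ₘ[μ] E)) hr hI _ _).1 hδ
  have hxi := hxs.integrable x
  have hkn : Integrable (fun ω => -k ω) μ := hk.neg
  have hki : Integrable (fun ω => -k ω + xs ω ((x : Ω →ₘ[μ] E) ω)) μ := hkn.add hxi
  have hle := upperIntegral_le_integral (hw.add (hki.const_mul r))
    (v := fun ω => f ω (((x₀ + r • x : X) : Ω →ₘ[μ] E) ω)) (by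
      filter_upwards [hfw, hkx, coeFn_add_smul x₀ x r] with ω h1 h2 h3
      rw [h3]
      exact (tiltedQuot_le_coe_iff hr h1 _ _).1 h2)
  have hint : ∫ ω, (w ω + r * (-k ω + xs ω ((x : Ω →ₘ[μ] E) ω))) ∂μ =
      ∫ ω, w ω ∂μ + r * (-∫ ω, k ω ∂μ + ℓ x) := by
    rw [integral_add hw (hki.const_mul r), integral_const_mul, integral_add hkn hxi,
      integral_neg, hxs.pairing]
  simp only [Pi.add_apply] at hle
  rw [hint] at hle
  have h1 := EReal.coe_le_coe_iff.1 (hδ.trans hle)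
  have h2 : r * (-δ + ℓ x) ≤ r * (-∫ ω, k ω ∂μ + ℓ x) := by linarith
  have := le_of_mul_le_mul_left h2 hr
  linarith

theorem measurable_tiltedQuot [TopologicalSpace.SeparableSpace E] [MeasurableSpace E]
    [BorelSpace E] (hf : Measurable (Function.uncurry f)) (hxs : RepresentsDual N xs ℓ) (r : ℝ) :
    Measurable (Function.uncurry (tiltedQuot f xs (x₀ : Ω →ₘ[μ] E) r)) := by
  have : SecondCountableTopology E := UniformSpace.secondCountable_of_separable E
  have hx₀ : Measurable fun p : Ω × E => (x₀ : Ω →ₘ[μ] E) p.1 :=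
    (x₀ : Ω →ₘ[μ] E).measurable.comp measurable_fst
  have hxsm : Measurable (fun p : Ω × E => xs p.1 p.2) := by
    -- A Carathéodory argument: the pairing is continuous in `e` and measurable in `ω`.
    have := measurable_uncurry_of_continuous_of_measurable (u := fun (e : E) (ω : Ω) => xs ω e)
      (fun ω => (xs ω).continuous) hxs.measurable
    exact this.comp measurable_swap
  have hF : ∀ g : Ω × E → E, Measurable g → Measurable fun p : Ω × E =>
      f p.1 (g p) - ((xs p.1 (g p) : ℝ) : EReal) := fun g hg =>
    (hf.comp (measurable_fst.prodMk hg)).add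
      ((hxsm.comp (measurable_fst.prodMk hg)).coe_real_ereal.neg)
  exact measurable_const.mul ((hF _ (hx₀.add (measurable_snd.const_smul r))).add
    (hF _ hx₀).neg)

/-- The excess of `-[f - ⟨xs, ·⟩](x₀, ·, r)` over `ε ψ`. -/
def excess (f : Ω → E → EReal) (xs : Ω → StrongDual ℝ E) (x₀ : Ω → E) (ψ : Ω → E → EReal)
    (ε r : ℝ) (ω : Ω) (e : E) : ENNReal :=
  (-tiltedQuot f xs x₀ r ω e - (ε : EReal) * ψ ω e).toENNReal

theorem measurable_excess [TopologicalSpace.SeparableSpace E] [MeasurableSpace E]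
    [BorelSpace E] (hf : Measurable (Function.uncurry f)) (hxs : RepresentsDual N xs ℓ)
    {ψ : Ω → E → EReal} (hψ : Measurable (Function.uncurry ψ)) (ε r : ℝ) :
    Measurable (Function.uncurry (excess f xs (x₀ : Ω →ₘ[μ] E) ψ ε r)) :=
  Measurable.ereal_toENNReal
    ((measurable_tiltedQuot hf hxs r).neg.add (measurable_const.mul hψ).neg)

theorem le_neg_of_ofReal_le_toENNReal_neg {q : EReal} (hq : q ≤ 0) {k : ℝ}
    (h : ENNReal.ofReal k ≤ (-q).toENNReal) : q ≤ ((-k : ℝ) : EReal) := by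
  induction q with
  | bot => exact bot_le
  | top => simp at hq
  | coe z =>
    have hz : z ≤ 0 := by exact_mod_cast hq
    rw [← EReal.coe_neg, EReal.toENNReal_of_ne_top (EReal.coe_ne_top _), EReal.toReal_coe,
      ENNReal.ofReal_le_ofReal_iff (by linarith)] at h
    rw [EReal.coe_le_coe_iff]
    linarith

section Pointwise

variable {x₁ : Ω → E} {ψ : Ω → E → EReal} {ε r : ℝ} {ω : Ω} {e : E}

omit [MeasurableSpace Ω] in
-- Where `ψ = ⊤` the excess vanishes, even for quotient `⊥`, by the convention `⊤ - ⊤ = ⊥`.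
theorem ne_top_and_tiltedQuot_le_of_excess_ne_zero (hε : 0 < ε) (hψ : 0 ≤ ψ ω e)
    (h : excess f xs x₁ ψ ε r ω e ≠ 0) :
    ψ ω e ≠ ⊤ ∧ tiltedQuot f xs x₁ r ω e ≤ ((-(ε * (ψ ω e).toReal) : ℝ) : EReal) := by
  have h' : 0 < -tiltedQuot f xs x₁ r ω e - (ε : EReal) * ψ ω e := by
    by_contra! hcon
    exact h (EReal.toENNReal_of_nonpos hcon)
  induction hψe : ψ ω e with
  | bot => simp [hψe] at hψ
  | top =>
    rw [hψe, EReal.coe_mul_top_of_pos hε] at h'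
    simp at h'
  | coe y =>
    refine ⟨EReal.coe_ne_top _, ?_⟩
    rw [hψe] at h'
    rw [EReal.toReal_coe]
    induction hz : tiltedQuot f xs x₁ r ω e with
    | bot => exact bot_le
    | top =>
      rw [hz] at h'
      simp at h'
    | coe z =>
      rw [hz] at h'
      norm_cast at h' ⊢
      linarith

omit [MeasurableSpace Ω] in
theorem excess_le (hε : 0 ≤ ε) (hψ : 0 ≤ ψ ω e) :
    excess f xs x₁ ψ ε r ω e ≤ (-tiltedQuot f xs x₁ r ω e).toENNReal := by
  refine EReal.toENNReal_le_toENNReal ?_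
  refine (EReal.sub_le_sub le_rfl (mul_nonneg (EReal.coe_nonneg.2 hε) hψ)).trans ?_
  simp

omit [MeasurableSpace Ω] in
theorem neg_sub_le_tiltedQuot_of_excess_le (hε : 0 < ε) (hψ : 0 ≤ ψ ω e) {u : ENNReal}
    (hu : u ≠ ⊤) (h : excess f xs x₁ ψ ε r ω e ≤ u) :
    -((ε : EReal) * ψ ω e) - ((u.toReal : ℝ) : EReal) ≤ tiltedQuot f xs x₁ r ω e := by
  induction hψe : ψ ω e with
  | bot => simp [hψe] at hψ
  | top => simp [EReal.coe_mul_top_of_pos hε]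
  | coe y =>
    simp only [excess, hψe] at h
    induction hz : tiltedQuot f xs x₁ r ω e with
    | bot =>
      rw [hz, EReal.neg_bot, ← EReal.coe_mul, EReal.top_sub_coe, EReal.toENNReal_top] at h
      exact absurd (top_le_iff.1 h) hu
    | top => exact le_top
    | coe z =>
      rw [hz] at h
      norm_cast at h ⊢
      rw [EReal.toENNReal_of_ne_top (EReal.coe_ne_top _), EReal.toReal_coe,
        ENNReal.ofReal_le_iff_le_toReal hu] at h
      linarith

end Pointwise

/-- The excess is bounded in mean on `X` if the quotients of `I_f` are bounded below on the
unit sublevel set of `I_ψ`. -/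
theorem lintegral_excess_le [SigmaFinite μ] [TopologicalSpace.SeparableSpace E]
    [MeasurableSpace E] [BorelSpace E] (hμ : IsAtomless μ) (hdec : Decomposable X)
    {r δ ε : ℝ} (hr : 0 < r) (hε : 0 < ε) (hδε : δ < ε / 2) (hw : Integrable w μ)
    (hfw : ∀ᵐ ω ∂μ, f ω ((x₀ : Ω →ₘ[μ] E) ω) = (w ω : EReal))
    (hI : integralFunctional μ f (x₀ : Ω →ₘ[μ] E) = ((∫ ω, w ω ∂μ : ℝ) : EReal))
    (hf : Measurable (Function.uncurry f)) (hxs : RepresentsDual N xs ℓ)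
    {ψ : Ω → E → EReal} (hψ : Measurable (Function.uncurry ψ))
    (hψ0 : ∀ᵐ ω ∂μ, ∀ e, 0 ≤ ψ ω e) (hψz : ∀ᵐ ω ∂μ, ψ ω 0 = 0)
    (hδ : ∀ x : X, integralFunctional μ ψ (x : Ω →ₘ[μ] E) ≤ ((1 : ℝ) : EReal) →
      ((-δ : ℝ) : EReal) ≤ diffQuot (fun x : X => integralFunctional μ f (x : Ω →ₘ[μ] E))
        x₀ x r - ((ℓ x : ℝ) : EReal)) (x : X) :
    ∫⁻ ω, excess f xs (x₀ : Ω →ₘ[μ] E) ψ ε r ω ((x : Ω →ₘ[μ] E) ω) ∂μ ≤ ENNReal.ofReal δ := by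
  have : SecondCountableTopology E := UniformSpace.secondCountable_of_separable E
  set v : Ω → ENNReal := fun ω => excess f xs (x₀ : Ω →ₘ[μ] E) ψ ε r ω ((x : Ω →ₘ[μ] E) ω)
  have hv : Measurable v := 
    measurable_apply_coeFn (measurable_excess hf hxs hψ ε r) (x : Ω →ₘ[μ] E)
  set p : Ω → ENNReal := fun ω => (ψ ω ((x : Ω →ₘ[μ] E) ω)).toENNReal
  have hp : Measurable p := 
    (measurable_apply_coeFn hψ (x : Ω →ₘ[μ] E)).ereal_toENNReal
  have hA : MeasurableSet {ω | v ω ≠ 0} := hv (measurableSet_singleton 0).compl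
  have hpA : ∀ᵐ ω ∂μ, ω ∈ {ω | v ω ≠ 0} → p ω ≠ ⊤ := by
    filter_upwards [hψ0] with ω h1 h2
    exact EReal.toENNReal_ne_top_iff.2 (ne_top_and_tiltedQuot_le_of_excess_ne_zero hε (h1 _) h2).1
  -- the restrictions of `x` on which the hypothesis can be used
  have key : ∀ B ⊆ {ω | v ω ≠ 0}, MeasurableSet B → ∫⁻ ω in B, p ω ∂μ ≤ 1 →
      Integrable (B.indicator fun ω => (p ω).toReal) μ ∧ ∃ y : X,
      (∀ᵐ ω ∂μ, (ω ∈ B → (y : Ω →ₘ[μ] E) ω = (x : Ω →ₘ[μ] E) ω) ∧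
        (ω ∉ B → (y : Ω →ₘ[μ] E) ω = 0)) ∧
      (∀ᵐ ω ∂μ, tiltedQuot f xs (x₀ : Ω →ₘ[μ] E) r ω ((y : Ω →ₘ[μ] E) ω) ≤
        ((-(ε * B.indicator (fun ω => (p ω).toReal) ω) : ℝ) : EReal)) ∧
      ((-δ : ℝ) : EReal) ≤ diffQuot (fun x : X => integralFunctional μ f (x : Ω →ₘ[μ] E))
        x₀ y r - ((ℓ y : ℝ) : EReal) := by
    intro B hBA hB hB1
    have hpi : Integrable (B.indicator fun ω => (p ω).toReal) μ := by
      rw [integrable_indicator_iff hB]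
      exact integrable_toReal_of_lintegral_ne_top hp.aemeasurable.restrict
        (hB1.trans_lt ENNReal.one_lt_top).ne
    obtain ⟨y, hy⟩ := hdec.exists_indicator x hB
    refine ⟨hpi, y, hy, ?_, hδ y ?_⟩
    · filter_upwards [hy, hψ0, hfw] with ω h1 h2 h3
      by_cases hω : ω ∈ B
      · rw [h1.1 hω, indicator_of_mem hω]
        have := (ne_top_and_tiltedQuot_le_of_excess_ne_zero hε (h2 _) (hBA hω)).2
        rwa [← EReal.toReal_toENNReal (h2 _)] at this
      · rw [h1.2 hω, indicator_of_notMem hω, tiltedQuot_zero h3]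
        simp
    · refine (upperIntegral_le_integral hpi ?_).trans ?_
      · filter_upwards [hy, hψ0, hψz, hpA] with ω h1 h2 h3 h4
        by_cases hω : ω ∈ B
        · rw [h1.1 hω, indicator_of_mem hω, EReal.toReal_toENNReal (h2 _), EReal.coe_toReal]
          · exact EReal.toENNReal_ne_top_iff.1 (h4 (hBA hω))
          · exact (lt_of_lt_of_le EReal.bot_lt_zero (h2 _)).ne'
        · rw [h1.2 hω, indicator_of_notMem hω, h3]
          simp
      · rw [EReal.coe_le_coe_iff, integral_indicator hB, integral_toReal hp.aemeasurable.restrict]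
        · exact ENNReal.toReal_le_of_le_ofReal zero_le_one (by simpa using hB1)
        · exact ae_lt_top hp (hB1.trans_lt ENNReal.one_lt_top).ne
  rcases le_or_gt (∫⁻ ω in {ω | v ω ≠ 0}, p ω ∂μ) 1 with h1 | h1
  · obtain ⟨-, y, hy, hyq, hyδ⟩ := key _ subset_rfl hA h1
    have hle : ∫⁻ ω, (-tiltedQuot f xs (x₀ : Ω →ₘ[μ] E) r ω ((y : Ω →ₘ[μ] E) ω)).toENNReal ∂μ ≤
        ENNReal.ofReal δ := by
      refine lintegral_le_of_forall_integrable_le fun k hk hk0 hkF => ?_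
      refine ENNReal.ofReal_le_ofReal (integral_le_of_tiltedQuot_le_neg hr hw hfw hI hxs hyδ hk ?_)
      filter_upwards [hyq] with ω h2
      have h3 : tiltedQuot f xs (x₀ : Ω →ₘ[μ] E) r ω ((y : Ω →ₘ[μ] E) ω) ≤ 0 := by
        refine h2.trans (EReal.coe_nonpos.2 (neg_nonpos.2 (mul_nonneg hε.le ?_)))
        exact indicator_nonneg (fun _ _ => ENNReal.toReal_nonneg) _
      exact le_neg_of_ofReal_le_toENNReal_neg h3 (hkF ω)
    refine le_trans (lintegral_mono_ae ?_) hle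
    filter_upwards [hy, hψ0] with ω h2 h3
    by_cases hω : v ω = 0
    · exact hω.trans_le zero_le
    · rw [h2.1 hω]
      exact excess_le hε.le (h3 _)
  -- Large mass: the lower bound `1 / 2` on the integral over `B` gives `ε / 2 ≤ δ`, contradicting
  -- `hδε`.
  · obtain ⟨B, hBA, hB, hB2, hB1⟩ := hμ.exists_setLIntegral_mem_Icc hp hA hpA h1
    obtain ⟨hpi, y, hy, hyq, hyδ⟩ := key B hBA hB hB1
    have := integral_le_of_tiltedQuot_le_neg hr hw hfw hI hxs hyδ (hpi.const_mul ε) hyq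
    rw [integral_const_mul, integral_indicator hB, integral_toReal hp.aemeasurable.restrict
      (ae_lt_top hp (hB1.trans_lt ENNReal.one_lt_top).ne)] at this
    have h2 : 1 / 2 ≤ (∫⁻ ω in B, p ω ∂μ).toReal := by
      have := ENNReal.toReal_mono (hB1.trans_lt ENNReal.one_lt_top).ne hB2
      simpa using this
    have := mul_le_mul_of_nonneg_left h2 hε.le
    linarith

theorem lowerGrowth_of_zero_le_liminf [SigmaFinite μ] [CompleteSpace E]
    [TopologicalSpace.SeparableSpace E] [MeasurableSpace E] [BorelSpace E] (hμ : IsAtomless μ)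
    (hdec : Decomposable X) (hD : PropertyD X) (hℬ : IsIntegralBornology ℬ φ)
    (hw : Integrable w μ)
    (hfw : ∀ᵐ ω ∂μ, f ω ((x₀ : Ω →ₘ[μ] E) ω) = (w ω : EReal))
    (hI : integralFunctional μ f (x₀ : Ω →ₘ[μ] E) = ((∫ ω, w ω ∂μ : ℝ) : EReal))
    (hf : Measurable (Function.uncurry f)) (hφ : ∀ i, Measurable (Function.uncurry (φ i)))
    (hxs : RepresentsDual N xs ℓ)
    (h : ∀ B : Set X, @Bornology.IsBounded X ℬ B → 0 ≤ liminf (fun r : ℝ => ⨅ x ∈ B,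
      (diffQuot (fun x : X => integralFunctional μ f (x : Ω →ₘ[μ] E)) x₀ x r -
        ((ℓ x : ℝ) : EReal))) (𝓝[>] 0)) :
    LowerGrowth μ φ f xs (x₀ : Ω →ₘ[μ] E) := by
  intro i ε hε
  let c : ℝ → ENNReal := fun r =>
    ⨆ x : X, ∫⁻ ω, excess f xs (x₀ : Ω →ₘ[μ] E) (φ i) ε r ω ((x : Ω →ₘ[μ] E) ω) ∂μ
  have hc : Tendsto c (𝓝[>] 0) (𝓝 0) := by
    refine ENNReal.tendsto_nhds_zero.2 fun η hη => ?_
    -- Besides being below `η`, `δ` must stay under `ε / 2` to exclude the large mass case.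
    obtain ⟨δ, hδ0, hδε, hδη⟩ : ∃ δ : ℝ, 0 < δ ∧ δ < ε / 2 ∧ ENNReal.ofReal δ ≤ η := by
      rcases eq_or_ne η ⊤ with rfl | hηtop
      · exact ⟨ε / 4, by linarith, by linarith, le_top⟩
      · have := ENNReal.toReal_pos hη.ne' hηtop
        refine ⟨min (ε / 4) η.toReal, lt_min (by linarith) this,
          (min_le_left _ _).trans_lt (by linarith), ?_⟩
        exact ENNReal.ofReal_le_of_le_toReal (min_le_right _ _)
    have hlt := (h {x | integralFunctional μ (φ i) (x : Ω →ₘ[μ] E) ≤ ((1 : ℝ) : EReal)}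
      ((hℬ.isBounded_iff _).2 ⟨i, 1, fun x hx => hx⟩))
    have hev := eventually_lt_of_lt_liminf (lt_of_lt_of_le
      (show ((-δ : ℝ) : EReal) < 0 by exact_mod_cast neg_lt_zero.2 hδ0) hlt)
    filter_upwards [hev, self_mem_nhdsWithin] with r hr1 hr
    refine (iSup_le fun x => ?_).trans hδη
    exact lintegral_excess_le hμ hdec hr hε hδε hw hfw hI hf hxs (hφ i) (hℬ.nonneg i)
      (hℬ.map_zero i) (fun y hy => hr1.le.trans (iInf₂_le y hy)) x
  have hbound : ∀ r, c r ≠ ⊤ → ∃ u : Ω → ENNReal, Measurable u ∧ ∫⁻ ω, u ω ∂μ ≤ c r ∧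
      ∀ᵐ ω ∂μ, ∀ e, excess f xs (x₀ : Ω →ₘ[μ] E) (φ i) ε r ω e ≤ u ω := fun r hr =>
    exists_ae_forall_le_of_lintegral_le hdec hD (measurable_excess hf hxs (hφ i) ε r) hr
      fun x => le_iSup (fun x : X => ∫⁻ ω, excess f xs (x₀ : Ω →ₘ[μ] E) (φ i) ε r ω
        ((x : Ω →ₘ[μ] E) ω) ∂μ) x
  choose! u hum huc hu using hbound
  have hfin : ∀ᶠ r in 𝓝[>] (0 : ℝ), c r ≠ ⊤ :=
    (hc.eventually (gt_mem_nhds ENNReal.zero_lt_top)).mono fun r hr => hr.ne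
  refine ⟨fun r ω => (u r ω).toReal, fun r _ => Eventually.of_forall fun ω =>
    ENNReal.toReal_nonneg, ?_, ?_, ?_⟩
  · filter_upwards [hfin] with r hr
    exact integrable_toReal_of_lintegral_ne_top (hum r hr).aemeasurable
      ((huc r hr).trans_lt hr.lt_top).ne
  · refine tendsto_of_tendsto_of_tendsto_of_le_of_le' tendsto_const_nhds hc
      (Eventually.of_forall fun _ => zero_le) ?_
    filter_upwards [hfin] with r hr
    rw [eLpNorm_one_eq_lintegral_enorm]
    refine le_trans (lintegral_mono fun ω => ?_) (huc r hr)
    rw [Real.enorm_of_nonneg ENNReal.toReal_nonneg]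
    exact ENNReal.ofReal_toReal_le
  · filter_upwards [hfin] with r hr
    filter_upwards [hu r hr, ae_lt_top (hum r hr) ((huc r hr).trans_lt hr.lt_top).ne,
      hℬ.nonneg i] with ω h1 h2 h3 e
    exact neg_sub_le_tiltedQuot_of_excess_le hε (h3 e) h2.ne (h1 e)

end FunctionSpace

end IntegralSubdiff

end

theorem theorem9p2
    {Ω : Type*} [MeasurableSpace Ω] (μ : Measure Ω) [SigmaFinite μ] [μ.IsComplete]
    {E : Type*} [NormedAddCommGroup E] [NormedSpace ℝ E] [CompleteSpace E]
    [TopologicalSpace.SeparableSpace E] [MeasurableSpace E] [BorelSpace E]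
    (X : Submodule ℝ (Ω →ₘ[μ] E)) (N : Seminorm ℝ X) (hN : IntegralSubdiff.IsNorm N)
    (hdec : IntegralSubdiff.Decomposable X) (hD : IntegralSubdiff.PropertyD X)
    (f : Ω → E → EReal) (hf : Measurable (Function.uncurry f))
    {ι : Type*} (φ : ι → Ω → E → EReal) (ℬ : Bornology X)
    (hℬ : IntegralSubdiff.IsIntegralBornology ℬ φ)
    (x₀ : X)
    (hx₀ : IntegralSubdiff.integralFunctional μ f (x₀ : Ω →ₘ[μ] E) ≠ ⊤)
    (hx₀' : IntegralSubdiff.integralFunctional μ f (x₀ : Ω →ₘ[μ] E) ≠ ⊥)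
    (xs : Ω → StrongDual ℝ E) (ℓ : X →ₗ[ℝ] ℝ)
    (hxs : IntegralSubdiff.RepresentsDual N xs ℓ) :
    (IntegralSubdiff.LowerGrowth μ φ f xs (x₀ : Ω →ₘ[μ] E) →
      IntegralSubdiff.IsSubderivative ℬ
        (fun x : X => IntegralSubdiff.integralFunctional μ f (x : Ω →ₘ[μ] E)) x₀ ℓ) ∧
    (IntegralSubdiff.IsAtomless μ → (∀ i, Measurable (Function.uncurry (φ i))) →
      (IntegralSubdiff.LowerGrowth μ φ f xs (x₀ : Ω →ₘ[μ] E) ↔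
        IntegralSubdiff.IsSubderivative ℬ
          (fun x : X => IntegralSubdiff.integralFunctional μ f (x : Ω →ₘ[μ] E)) x₀ ℓ)) := by
  have : SecondCountableTopology E := UniformSpace.secondCountable_of_separable E
  obtain ⟨w, hw, hfw, hI⟩ := IntegralSubdiff.exists_integrable_eq_of_upperIntegral_finite
    (IntegralSubdiff.measurable_apply_coeFn hf (x₀ : Ω →ₘ[μ] E)) hx₀ hx₀'
  have hba : IntegralSubdiff.LowerGrowth μ φ f xs (x₀ : Ω →ₘ[μ] E) →
      IntegralSubdiff.IsSubderivative ℬ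
        (fun x : X => IntegralSubdiff.integralFunctional μ f (x : Ω →ₘ[μ] E)) x₀ ℓ := fun h =>
    ⟨hx₀, hx₀', fun _ hB => h.zero_le_liminf hℬ hw hfw hI hxs hB⟩
  refine ⟨hba, fun hμ hφ => ⟨hba, fun h => ?_⟩⟩
  exact IntegralSubdiff.lowerGrowth_of_zero_le_liminf hμ hdec hD hℬ hw hfw hI hf hφ hxs h.2.2
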